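/- All topological groups and fields are Hausdorff. A topological group $G$ is called minimal if its topology has no strictly coarser Hausdorff group topology. A local field is a non-discrete locally compact topological field. For a topological field $F$ and $n\in\mathbb N$, let $\mathrm{SUT}(n,F)$ be the group of upper triangular $n\times n$ matrices over $F$ with determinant $1$, with the pointwise topology inherited from $F^{n^2}$. Theorem. Let $F$ be a local field of characteristic different from $2$. Then $\mathrm{SUT}(n,F)$ is a minimal topological group for every $n\in\mathbb N$. -/

import Mathlib

/-- A topological group `G` is minimal if it is Hausdorff and its topology `t` admits no strictly
coarser Hausdorff group topology. In Mathlib's order, `t ≤ s` says that `s` is coarser than `t`. -/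
structure IsMinimalTopologicalGroup (G : Type*) [Group G] [t : TopologicalSpace G] : Prop where
  isTopologicalGroup : IsTopologicalGroup G
  t2Space : T2Space G
  eq_of_coarser : ∀ s : TopologicalSpace G,
    @IsTopologicalGroup G s _ → @T2Space G s → t ≤ s → s = t

/-- A local field is a non-discrete locally compact (Hausdorff) topological field. -/
class IsTopologicalLocalField (F : Type*) [Field F] [TopologicalSpace F] : Prop extends
    IsTopologicalDivisionRing F, T2Space F, LocallyCompactSpace F where
  not_discrete : ¬ DiscreteTopology F

/-- The special upper triangular group `SUT(n, F)`: upper triangular matrices of determinant one.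
As a subgroup of `SL(n, F)` it carries the topology of entrywise convergence, inherited from
`n × n` matrices. -/
def specialUpperTriangularGroup (n : ℕ) (F : Type*) [Field F] :
    Subgroup (Matrix.SpecialLinearGroup (Fin n) F) where
  carrier := {A | ∀ i j : Fin n, j < i → A i j = 0}
  one_mem' := fun i j h => by
    simp [h.ne']
  mul_mem' := fun {A B} hA hB => by
    have h : ((A : Matrix (Fin n) (Fin n) F) * B).BlockTriangular id :=
      Matrix.BlockTriangular.mul (fun i j h => hA i j h) (fun i j h => hB i j h)
    intro i j hij
    exact h hij
  inv_mem' := fun {A} hA => by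
    have hT : (A : Matrix (Fin n) (Fin n) F).BlockTriangular id := fun i j h => hA i j h
    have hm : (A : Matrix (Fin n) (Fin n) F) * ((A⁻¹ : Matrix.SpecialLinearGroup (Fin n) F) :
        Matrix (Fin n) (Fin n) F) = 1 := by
      rw [← Matrix.SpecialLinearGroup.coe_mul, mul_inv_cancel, Matrix.SpecialLinearGroup.coe_one]
    let _ : Invertible (A : Matrix (Fin n) (Fin n) F) :=
      ⟨_, mul_eq_one_comm.mp hm, hm⟩
    have h := Matrix.blockTriangular_inv_of_blockTriangular hT
    rw [Matrix.inv_eq_right_inv hm] at h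
    intro i j hij
    exact h hij

/-!
# Minimality of `SUT(n, F)` over a local field

Let `φ` be an injective continuous homomorphism from `SUT(n, F)` to a Hausdorff group; the case of
interest is the identity into a coarser group topology. It suffices to show that an ultrafilter
`U` with `φ (g) → 1` along `U` satisfies `g → 1` entrywise. Three facts drive the argument.

* A function into a local field either converges along `U` or has inverse tending to `0`
  (`Ultrafilter.exists_tendsto_nhds_or_tendsto_inv_zero`).
* If `φ (u i)` tends to an element commuting with the image of `φ` and `h i` converges in
  `SUT(n, F)`, then `φ` of the commutator of `u i` and `h i` tends to `1`. If these commutators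
  converge in `SUT(n, F)` to a nontrivial element, this contradicts injectivity.
* The unipotent matrices `[1, v; 0, 1]` form an abelian normal subgroup, on which conjugation acts
  linearly (`specialUpperTriangularGroup.firstRow_conj`).

Suppose that `φ [1, v i; 0, 1]` tends to a central element. If an entry of `v i` other than the last
one tended to infinity, commutators with small elementary matrices in the last column would converge
to the nontrivial element with entry `1` in the top right corner. If the last entry did so,
commutators with diagonal matrices `diag(d, 1, …, 1, d⁻¹)`, `d → 1`, would do the same; here
`d ^ 2 - 1` has to be comparable with `d - 1`, which is where the characteristic enters. So `v i`
converges (`specialUpperTriangularGroup.exists_tendsto_firstRow`).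

For general `g` with `φ (g) → 1`, write `a` for its top left entry and `B` for the block obtained by
deleting the first row and column. Commutators of `g` with the matrices `[1, e; 0, 1]` for basis
vectors `e` show that `a⁻¹ • B → 1`, and the determinant then shows that `a` converges. Hence `g` is
a product of a family converging to a scalar matrix and of a family of matrices `[1, v; 0, 1]`; the
image of the latter tends to a central element, so `v` converges, and therefore so does `g`.
-/

open Filter Topology Matrix

/-! ### Compactness in a local field -/

section LocalField

variable {F : Type*} [Field F] [TopologicalSpace F] [IsTopologicalLocalField F]

/-- A local field has an element `r ≠ 0` and a compact neighbourhood `V` of `0` such that `V`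
contains the positive powers of `r`, and these powers accumulate at `0`. -/
theorem exists_compact_nhds_zero_pow_accumulating :
    ∃ (V : Set F) (r : F), IsCompact V ∧ V ∈ 𝓝 (0 : F) ∧ r ≠ 0 ∧ (∀ n : ℕ, r ^ (n + 1) ∈ V) ∧
      (0 : F) ∈ closure (Set.range fun n : ℕ => r ^ (n + 1)) := by
  obtain ⟨V, hV0, hV1, hVc⟩ := LocallyCompactSpace.local_compact_nhds (0 : F) {1}ᶜ
    (isOpen_compl_singleton.mem_nhds (by simp))
  have hW : ∀ᶠ w in 𝓝 (0 : F), ∀ v ∈ V, w * v ∈ V := by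
    refine hVc.eventually_forall_of_forall_eventually fun v _ => ?_
    have h : Tendsto (fun z : F × F => z.1 * z.2) (𝓝 (0, v)) (𝓝 (0 * v)) :=
      (continuous_fst.mul continuous_snd).tendsto _
    rw [zero_mul] at h
    exact h hV0
  have hne : (𝓝[≠] (0 : F)).NeBot := by
    rw [neBot_iff, Ne, ← isOpen_singleton_iff_punctured_nhds,
      ← discreteTopology_iff_isOpen_singleton_zero]
    exact IsTopologicalLocalField.not_discrete
  obtain ⟨r, ⟨hrW, hrV⟩, hr0⟩ := (((hW.and hV0).filter_mono nhdsWithin_le_nhds).and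
    (eventually_mem_nhdsWithin (a := (0 : F)) (s := {0}ᶜ))).exists
  have hpow : ∀ n : ℕ, r ^ (n + 1) ∈ V := by
    intro n
    induction n with
    | zero => rw [zero_add, pow_one]; exact hrV
    | succ n ih => rw [pow_succ']; exact hrW _ ih
  refine ⟨V, r, hVc, hV0, hr0, hpow, ?_⟩
  let S : Subsemigroup F :=
    { carrier := Set.range fun n : ℕ => r ^ (n + 1)
      mul_mem' := by
        rintro _ _ ⟨a, rfl⟩ ⟨b, rfl⟩
        exact ⟨a + b + 1, by ring⟩ }
  have hSV : closure (S : Set F) ⊆ V :=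
    hVc.isClosed.closure_subset_iff.2 (Set.range_subset_iff.2 hpow)
  -- A compact semigroup contains an idempotent; as `1 ∉ V`, it can only be `0`.
  obtain ⟨e, heS, he⟩ := exists_idempotent_in_compact_subsemigroup
    (fun a : F => continuous_mul_const a) (closure (S : Set F))
    ⟨_, subset_closure ⟨0, rfl⟩⟩ (hVc.of_isClosed_subset isClosed_closure hSV)
    (fun x hx y hy => S.topologicalClosure.mul_mem hx hy)
  have he1 : e ≠ 1 := hV1 (hSV heS)
  have he0 : e = 0 := by
    by_contra h
    exact he1 (mul_left_cancel₀ h (by rw [he, mul_one]))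
  exact he0 ▸ heS

/-- In a local field the complement of a suitable compact set has relatively compact inverse. -/
theorem exists_isCompact_mem_or_inv_mem :
    ∃ K : Set F, IsCompact K ∧ ∀ x : F, x ∈ K ∨ x⁻¹ ∈ K := by
  classical
  obtain ⟨V, r, hVc, hV0, hr0, hpow, hacc⟩ := exists_compact_nhds_zero_pow_accumulating (F := F)
  let C : Set F := V ∩ {y | r⁻¹ * y ∈ (interior V)ᶜ}
  have hC : IsCompact C := hVc.inter_right
    (isOpen_interior.isClosed_compl.preimage (continuous_const_mul r⁻¹))
  have hC0 : ∀ y ∈ C, y ≠ 0 := by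
    rintro y ⟨-, hy⟩ rfl
    exact hy (by simpa using mem_interior_iff_mem_nhds.2 hV0)
  have hCinv : IsCompact ((fun y : F => y⁻¹) '' C) :=
    hC.image_of_continuousOn fun y hy => (continuousAt_inv₀ (hC0 y hy)).continuousWithinAt
  refine ⟨V ∪ (fun z : F × F => z.1 * z.2) '' (V ×ˢ ((fun y : F => y⁻¹) '' C)),
    hVc.union ((hVc.prod hCinv).image (continuous_fst.mul continuous_snd)), fun x => ?_⟩
  by_cases hx : x ∈ V
  · exact Or.inl (Or.inl hx)
  have hx0 : x ≠ 0 := fun h => hx (h ▸ mem_of_mem_nhds hV0)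
  have hex : ∃ n : ℕ, r ^ n * x ∈ V := by
    have h : {y : F | y * x ∈ V} ∈ 𝓝 (0 : F) := by
      have h : Tendsto (fun y : F => y * x) (𝓝 0) (𝓝 (0 * x)) :=
        (continuous_mul_const x).tendsto _
      rw [zero_mul] at h
      exact h hV0
    obtain ⟨_, hy, n, rfl⟩ := mem_closure_iff_nhds.1 hacc _ h
    exact ⟨n + 1, hy⟩
  -- The first power of `r` moving `x` into `V` moves it into the compact set `C ∌ 0`.
  obtain ⟨k, hk⟩ : ∃ k, Nat.find hex = k + 1 :=
    Nat.exists_eq_succ_of_ne_zero fun h => hx (by simpa [h] using Nat.find_spec hex)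
  have hkV : r ^ (k + 1) * x ∈ V := hk ▸ Nat.find_spec hex
  have hkV' : r ^ k * x ∉ V := Nat.find_min hex (by omega)
  refine Or.inr (Or.inr ⟨(r ^ (k + 1), (r ^ (k + 1) * x)⁻¹),
    ⟨hpow k, _, ⟨hkV, fun h => hkV' ?_⟩, rfl⟩, ?_⟩)
  · have : r⁻¹ * (r ^ (k + 1) * x) = r ^ k * x := by rw [pow_succ']; field_simp
    exact this ▸ interior_subset h
  · have := pow_ne_zero (k + 1) hr0
    field_simp

/-- Along an ultrafilter, a function into a local field converges or tends to infinity. -/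
theorem Ultrafilter.exists_tendsto_nhds_or_tendsto_inv_zero {ι : Type*} (U : Ultrafilter ι)
    (f : ι → F) :
    (∃ c, Tendsto f U (𝓝 c)) ∨
      (Tendsto (fun i => (f i)⁻¹) U (𝓝 0) ∧ ∀ᶠ i in (U : Filter ι), f i ≠ 0) := by
  obtain ⟨K, hK, hKinv⟩ := exists_isCompact_mem_or_inv_mem (F := F)
  have key : ∀ g : ι → F, (∀ᶠ i in (U : Filter ι), g i ∈ K) → ∃ c, Tendsto g U (𝓝 c) := by
    intro g hg
    obtain ⟨c, -, hc⟩ := hK.ultrafilter_le_nhds (U.map g) (le_principal_iff.2 hg)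
    exact ⟨c, hc⟩
  rcases Ultrafilter.eventually_or.1 (Eventually.of_forall (f := (U : Filter ι))
    fun i => hKinv (f i)) with h | h
  · exact Or.inl (key f h)
  obtain ⟨c, hc⟩ := key _ h
  by_cases hc0 : c = 0
  · subst hc0
    by_cases hf : ∀ᶠ i in (U : Filter ι), f i ≠ 0
    · exact Or.inr ⟨hc, hf⟩
    · refine Or.inl ⟨0, tendsto_const_nhds.congr' ?_⟩
      filter_upwards [Ultrafilter.eventually_not.2 hf] with i hi
      exact (not_not.1 hi).symm
  · exact Or.inl ⟨c⁻¹, by simpa using hc.inv₀ hc0⟩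

end LocalField

/-! ### Elements of the special upper triangular group -/

namespace specialUpperTriangularGroup

section Algebra

variable {F : Type*} [Field F] {n m : ℕ}

/-- An upper triangular matrix whose diagonal entries have product one, as an element of
`SUT(n, F)`. -/
def ofDiagProd (M : Matrix (Fin n) (Fin n) F) (hM : ∀ i j, j < i → M i j = 0)
    (hd : ∏ i, M i i = 1) : specialUpperTriangularGroup n F :=
  ⟨⟨M, by rw [det_of_isUpperTriangular (fun i j h => hM i j h), hd]⟩, hM⟩

theorem ext_entries {g h : specialUpperTriangularGroup n F}
    (H : ∀ i j, g.1.1 i j = h.1.1 i j) : g = h :=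
  Subtype.ext (Subtype.ext (Matrix.ext H))

theorem prod_diag (g : specialUpperTriangularGroup n F) : ∏ i, g.1.1 i i = 1 := by
  rw [← det_of_isUpperTriangular (fun i j h => g.2 i j h)]
  exact g.1.2

theorem diag_ne_zero (g : specialUpperTriangularGroup n F) (i : Fin n) : g.1.1 i i ≠ 0 := by
  have h : ∏ i, g.1.1 i i ≠ 0 := by simp [prod_diag g]
  exact Finset.prod_ne_zero_iff.1 h i (Finset.mem_univ i)

theorem mul_entry (g h : specialUpperTriangularGroup n F) (i j : Fin n) :
    (g * h).1.1 i j = ∑ k, g.1.1 i k * h.1.1 k j := rfl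

/-- The unipotent matrix with block form `[1, v; 0, 1]`, which differs from the identity only in
the first row. -/
def firstRow (v : Fin m → F) : specialUpperTriangularGroup (m + 1) F :=
  ofDiagProd
    (Matrix.of fun i j => Fin.cases (Fin.cases 1 v j)
      (fun i' => Fin.cases 0 (fun j' => (1 : Matrix (Fin m) (Fin m) F) i' j') j) i)
    (fun i j h => by
      induction i using Fin.cases with
      | zero => simp at h
      | succ i =>
        induction j using Fin.cases with
        | zero => simp
        | succ j => simpa using one_apply_ne (Fin.succ_lt_succ_iff.1 h).ne')
    (by simp [Fin.prod_univ_succ])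

@[simp] theorem firstRow_zero_zero (v : Fin m → F) : (firstRow v).1.1 0 0 = 1 := rfl
@[simp] theorem firstRow_zero_succ (v : Fin m → F) (j : Fin m) :
    (firstRow v).1.1 0 j.succ = v j := rfl
@[simp] theorem firstRow_succ_zero (v : Fin m → F) (i : Fin m) :
    (firstRow v).1.1 i.succ 0 = 0 := rfl
@[simp] theorem firstRow_succ_succ (v : Fin m → F) (i j : Fin m) :
    (firstRow v).1.1 i.succ j.succ = (1 : Matrix (Fin m) (Fin m) F) i j := rfl

theorem entry_succ_zero (g : specialUpperTriangularGroup (m + 1) F) (i : Fin m) :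
    g.1.1 i.succ 0 = 0 := g.2 _ _ (Fin.succ_pos i)

theorem firstRow_injective :
    Function.Injective (firstRow : (Fin m → F) → specialUpperTriangularGroup (m + 1) F) := by
  intro v w h
  funext j
  rw [← firstRow_zero_succ v, h, firstRow_zero_succ]

theorem firstRow_add (v w : Fin m → F) : firstRow (v + w) = firstRow v * firstRow w := by
  refine ext_entries fun i j => ?_
  rw [mul_entry, Fin.sum_univ_succ]
  induction i using Fin.cases <;> induction j using Fin.cases <;>
    simp [one_apply, add_comm]

theorem firstRow_zero : firstRow (0 : Fin m → F) = 1 := by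
  have h := firstRow_add (0 : Fin m → F) 0
  rw [add_zero] at h
  exact left_eq_mul.1 h

theorem firstRow_neg (v : Fin m → F) : firstRow (-v) = (firstRow v)⁻¹ :=
  eq_inv_of_mul_eq_one_left (by rw [← firstRow_add, neg_add_cancel, firstRow_zero])

/-- The action on first rows that describes conjugation: `firstRow_conj`. -/
def rowAction (g : specialUpperTriangularGroup (m + 1) F) (v : Fin m → F) : Fin m → F :=
  fun j => (g.1.1 0 0)⁻¹ * ∑ k, v k * g.1.1 k.succ j.succ

theorem firstRow_conj (g : specialUpperTriangularGroup (m + 1) F) (v : Fin m → F) :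
    g⁻¹ * firstRow v * g = firstRow (rowAction g v) := by
  rw [mul_assoc, inv_mul_eq_iff_eq_mul]
  refine ext_entries fun i j => ?_
  rw [mul_entry, mul_entry, Fin.sum_univ_succ, Fin.sum_univ_succ]
  have h0 := diag_ne_zero g 0
  induction i using Fin.cases <;> induction j using Fin.cases <;>
    simp [one_apply, rowAction, entry_succ_zero, h0, add_comm]

/-- The torus element `diag(d, 1, …, 1, d⁻¹)`. -/
def torus (d : Fˣ) : specialUpperTriangularGroup (m + 2) F :=
  ofDiagProd (diagonal (Fin.cons (d : F) (Pi.mulSingle (Fin.last m) (d⁻¹ : F))))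
    (fun i j h => diagonal_apply_ne _ h.ne')
    (by simp [Fin.prod_univ_succ (n := m + 1), Finset.prod_pi_mulSingle'])

/-- The elementary matrix with the entry `s` in row `k + 1` of the last column. -/
def lastColumn (k : Fin (m + 1)) (hk : k ≠ Fin.last m) (s : F) :
    specialUpperTriangularGroup (m + 2) F :=
  ofDiagProd (transvection k.succ (Fin.last m).succ s)
    (fun i j h => by
      have hlt : k < Fin.last m := Fin.lt_last_iff_ne_last.2 hk
      have : ¬ (k.succ = i ∧ (Fin.last m).succ = j) := by
        rintro ⟨rfl, rfl⟩
        exact absurd (Fin.succ_lt_succ_iff.1 h) hlt.not_gt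
      rw [transvection, Matrix.add_apply, one_apply_ne h.ne', single_apply, if_neg this, add_zero])
    (by
      refine Finset.prod_eq_one fun i _ => ?_
      have : ¬ (k.succ = i ∧ (Fin.last m).succ = i) := by
        rintro ⟨h, h'⟩
        exact hk (Fin.succ_injective _ (h.trans h'.symm))
      simp only [transvection, Matrix.add_apply, one_apply_eq, single_apply, if_neg this, add_zero])

theorem rowAction_torus (d : Fˣ) (v : Fin (m + 1) → F) (j : Fin (m + 1)) :
    rowAction (torus d⁻¹) v j = (if j = Fin.last m then (d : F) ^ 2 else d) * v j := by
  have : ∀ k, (torus d⁻¹ : specialUpperTriangularGroup (m + 2) F).1.1 k.succ j.succ =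
      if k = j then (if j = Fin.last m then (d : F) else 1) else 0 := by
    intro k
    simp only [torus, ofDiagProd, diagonal_apply, Fin.succ_inj, Fin.cons_succ]
    split_ifs with h1 h2 <;> simp_all
  have h0 : (torus d⁻¹ : specialUpperTriangularGroup (m + 2) F).1.1 0 0 = (d : F)⁻¹ := by
    simp [torus, ofDiagProd]
  simp only [rowAction, this, h0, inv_inv, mul_ite, mul_zero, Finset.sum_ite_eq', Finset.mem_univ,
    if_true]
  split_ifs <;> ring

theorem rowAction_lastColumn (k : Fin (m + 1)) (hk : k ≠ Fin.last m) (s : F)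
    (v : Fin (m + 1) → F) :
    rowAction (lastColumn k hk s) v = v + Pi.single (Fin.last m) (v k * s) := by
  funext j
  have : ∀ l, (lastColumn k hk s).1.1 l.succ j.succ =
      (if l = j then 1 else 0) + if l = k then (if j = Fin.last m then s else 0) else 0 := by
    intro l
    simp only [lastColumn, ofDiagProd, transvection, Matrix.add_apply, one_apply, single_apply,
      Fin.succ_inj]
    simp only [ite_and, eq_comm (a := k), eq_comm (a := Fin.last m)]
  have h0 : (lastColumn k hk s).1.1 0 0 = 1 := by
    simp [lastColumn, ofDiagProd, transvection]
  simp [rowAction, this, h0, mul_add, Finset.sum_add_distrib, Pi.single_apply]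

end Algebra

/-! ### The entrywise topology -/

section Topological

variable {F : Type*} [Field F] [TopologicalSpace F] {n m : ℕ} {ι : Type*} {l : Filter ι}

theorem tendsto_iff {g : ι → specialUpperTriangularGroup n F}
    {x : specialUpperTriangularGroup n F} :
    Tendsto g l (𝓝 x) ↔
      ∀ i j, Tendsto (fun a => (g a).1.1 i j) l (𝓝 (x.1.1 i j)) := by
  have h : IsInducing fun x : specialUpperTriangularGroup n F => x.1.1 :=
    (IsInducing.subtypeVal (t := {A : Matrix (Fin n) (Fin n) F | A.det = 1})).comp
      IsInducing.subtypeVal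
  exact h.tendsto_nhds_iff.trans
    (tendsto_pi_nhds.trans (forall_congr' fun i => tendsto_pi_nhds))

theorem tendsto_firstRow {v : ι → Fin m → F} {w : Fin m → F} (h : Tendsto v l (𝓝 w)) :
    Tendsto (fun a => firstRow (v a)) l (𝓝 (firstRow w)) := by
  refine tendsto_iff.2 fun i j => ?_
  induction i using Fin.cases with
  | zero =>
    induction j using Fin.cases with
    | zero => exact tendsto_const_nhds
    | succ j => exact tendsto_pi_nhds.1 h j
  | succ i => induction j using Fin.cases <;> exact tendsto_const_nhds

theorem tendsto_lastColumn [IsTopologicalRing F] (k : Fin (m + 1)) (hk : k ≠ Fin.last m)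
    {s : ι → F} (hs : Tendsto s l (𝓝 0)) :
    Tendsto (fun a => lastColumn k hk (s a)) l (𝓝 (lastColumn k hk 0)) := by
  refine tendsto_iff.2 fun i j => ?_
  simp only [lastColumn, ofDiagProd, transvection, Matrix.add_apply, single_apply]
  refine tendsto_const_nhds.add ?_
  split_ifs
  exacts [hs, tendsto_const_nhds]

theorem tendsto_torus [IsTopologicalDivisionRing F] {d : ι → Fˣ}
    (hd : Tendsto (fun a => (d a : F)) l (𝓝 1)) :
    Tendsto (fun a => (torus (d a) : specialUpperTriangularGroup (m + 2) F)) l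
      (𝓝 (torus 1)) := by
  refine tendsto_iff.2 fun i j => ?_
  by_cases hij : i = j
  · subst hij
    simp only [torus, ofDiagProd, diagonal_apply_eq]
    induction i using Fin.cases with
    | zero => simpa using hd
    | succ i =>
      by_cases hi : i = Fin.last m
      · subst hi
        simpa using hd.inv₀ one_ne_zero
      · simp [hi, tendsto_const_nhds]
  · simp only [torus, ofDiagProd, diagonal_apply_ne _ hij]
    exact tendsto_const_nhds

/-- `SUT(n, F)` is closed in the space of matrices. -/
theorem exists_tendsto [IsTopologicalRing F] [T2Space F] [l.NeBot]
    {g : ι → specialUpperTriangularGroup n F}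
    (h : ∀ i j, ∃ c, Tendsto (fun a => (g a).1.1 i j) l (𝓝 c)) : ∃ x, Tendsto g l (𝓝 x) := by
  choose M hM using h
  have htri : ∀ i j, j < i → M i j = 0 := fun i j hij =>
    tendsto_nhds_unique (hM i j)
      (tendsto_const_nhds.congr fun a => ((g a).2 i j hij).symm)
  have hdiag : ∏ i, M i i = 1 :=
    tendsto_nhds_unique (tendsto_finsetProd _ fun i _ => hM i i)
      (tendsto_const_nhds.congr fun a => (prod_diag (g a)).symm)
  exact ⟨ofDiagProd M htri hdiag, tendsto_iff.2 hM⟩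

end Topological

/-! ### Coarser Hausdorff group topologies -/

section Coarser

variable {F : Type*} [Field F] [TopologicalSpace F] {m : ℕ}
  {H : Type*} [Group H] [TopologicalSpace H] {ι : Type*}

theorem eq_zero_of_tendsto_firstRow [T2Space H] {φ : specialUpperTriangularGroup (m + 1) F →* H}
    (hφ : Continuous φ) (hinj : Function.Injective φ) {l : Filter ι} [l.NeBot]
    {v : ι → Fin m → F} {w : Fin m → F}
    (hv : Tendsto (fun i => φ (firstRow (v i))) l (𝓝 1)) (hw : Tendsto v l (𝓝 w)) : w = 0 := by
  have h : φ (firstRow w) = 1 :=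
    tendsto_nhds_unique ((hφ.tendsto _).comp (tendsto_firstRow hw)) hv
  refine firstRow_injective (hinj ?_)
  rw [h, firstRow_zero, map_one]

/-- If the images of first-row elements converge to an element commuting with the image of `φ`,
then commutators with a
convergent family of group elements become trivial in the limit. -/
theorem tendsto_firstRow_rowAction_sub [IsTopologicalGroup H]
    {φ : specialUpperTriangularGroup (m + 1) F →* H}
    (hφ : Continuous φ) {l : Filter ι} {v : ι → Fin m → F} {c : H} (hc : ∀ g, Commute c (φ g))
    (hv : Tendsto (fun i => φ (firstRow (v i))) l (𝓝 c))
    {g : ι → specialUpperTriangularGroup (m + 1) F} {x : specialUpperTriangularGroup (m + 1) F}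
    (hg : Tendsto g l (𝓝 x)) :
    Tendsto (fun i => φ (firstRow (rowAction (g i) (v i) - v i))) l (𝓝 1) := by
  have hφg : Tendsto (fun i => φ (g i)) l (𝓝 (φ x)) := (hφ.tendsto _).comp hg
  have h := ((hφg.inv.mul hv).mul hφg).mul hv.inv
  have h1 : (φ x)⁻¹ * c * φ x * c⁻¹ = 1 := by
    rw [mul_assoc (φ x)⁻¹, (hc x).eq]
    group
  rw [h1] at h
  refine h.congr fun i => ?_
  rw [sub_eq_add_neg, firstRow_add, firstRow_neg, ← firstRow_conj]
  simp only [map_mul, map_inv]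

/-- A family in a field that tends to `1` agrees eventually with a family of units. -/
theorem exists_units_eventuallyEq [T1Space F] {l : Filter ι} {d : ι → F} (hd : Tendsto d l (𝓝 1)) :
    ∃ u : ι → Fˣ, ∀ᶠ i in l, (u i : F) = d i := by
  classical
  refine ⟨fun i => if h : d i = 0 then 1 else Units.mk0 (d i) h, ?_⟩
  filter_upwards [hd.eventually_ne one_ne_zero] with i hi
  simp [hi]

variable [IsTopologicalLocalField F] [IsTopologicalGroup H] [T2Space H]

/-- If the images of first-row elements converge to a central element along an ultrafilter, then
all entries except possibly the last one converge: otherwise commutators with small elements of the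
last column would yield a fixed nontrivial element of the top right corner. -/
theorem exists_tendsto_of_ne_last {φ : specialUpperTriangularGroup (m + 2) F →* H}
    (hφ : Continuous φ) (hinj : Function.Injective φ) (U : Ultrafilter ι)
    {v : ι → Fin (m + 1) → F} {c : H} (hc : ∀ g, Commute c (φ g))
    (hv : Tendsto (fun i => φ (firstRow (v i))) U (𝓝 c)) (k : Fin (m + 1)) (hk : k ≠ Fin.last m) :
    ∃ a, Tendsto (fun i => v i k) U (𝓝 a) := by
  rcases U.exists_tendsto_nhds_or_tendsto_inv_zero fun i => v i k with h | ⟨h, hne⟩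
  · exact h
  have h1 := tendsto_firstRow_rowAction_sub hφ hc hv (tendsto_lastColumn k hk h)
  have h2 : Tendsto (fun i => rowAction (lastColumn k hk (v i k)⁻¹) (v i) - v i) U
      (𝓝 (Pi.single (Fin.last m) 1)) := by
    refine tendsto_const_nhds.congr' ?_
    filter_upwards [hne] with i hi
    rw [rowAction_lastColumn, add_sub_cancel_left, mul_inv_cancel₀ hi]
  have h3 := eq_zero_of_tendsto_firstRow hφ hinj h1 h2
  simp at h3

/-- If the images of first-row elements converge to a central element along an ultrafilter, then
the last entry converges too. Otherwise commutators with `diag(d, 1, …, 1, d⁻¹)`, where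
`d = 1 + x` and `x` is half the inverse of the last entry, would converge to a nontrivial element
of the top right corner, because `(d ^ 2 - 1) / (2 * x) → 1`. -/
theorem exists_tendsto_last (h2 : (2 : F) ≠ 0)
    {φ : specialUpperTriangularGroup (m + 2) F →* H}
    (hφ : Continuous φ) (hinj : Function.Injective φ) (U : Ultrafilter ι)
    {v : ι → Fin (m + 1) → F} {c : H} (hc : ∀ g, Commute c (φ g))
    (hv : Tendsto (fun i => φ (firstRow (v i))) U (𝓝 c)) :
    ∃ a, Tendsto (fun i => v i (Fin.last m)) U (𝓝 a) := by
  rcases U.exists_tendsto_nhds_or_tendsto_inv_zero fun i => v i (Fin.last m) with h | ⟨h, hne⟩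
  · exact h
  have hx : Tendsto (fun i => 2⁻¹ * (v i (Fin.last m))⁻¹) U (𝓝 0) := by
    simpa using h.const_mul 2⁻¹
  have hd : Tendsto (fun i => 1 + 2⁻¹ * (v i (Fin.last m))⁻¹) U (𝓝 1) := by
    simpa using hx.const_add 1
  obtain ⟨u, hu⟩ := exists_units_eventuallyEq hd
  have hu1 : Tendsto (fun i => ((u i)⁻¹ : Fˣ).val) U (𝓝 1) := by
    simpa using (hd.congr' (hu.mono fun i hi => hi.symm)).inv₀ one_ne_zero
  have h3 := tendsto_firstRow_rowAction_sub hφ hc hv (tendsto_torus hu1)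
  have h4 : Tendsto (fun i => rowAction (torus (u i)⁻¹) (v i) - v i) U
      (𝓝 (Pi.single (Fin.last m) 1)) := by
    refine tendsto_pi_nhds.2 fun k => ?_
    by_cases hk : k = Fin.last m
    · subst hk
      have h5 : Tendsto (fun i => 1 + 2⁻¹ * (2⁻¹ * (v i (Fin.last m))⁻¹)) U (𝓝 1) := by
        simpa using (hx.const_mul 2⁻¹).const_add 1
      rw [Pi.single_eq_same]
      refine h5.congr' ?_
      filter_upwards [hu, hne] with i hi hi0
      rw [Pi.sub_apply, rowAction_torus, if_pos rfl, hi]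
      field_simp
      ring
    · obtain ⟨a, ha⟩ := exists_tendsto_of_ne_last hφ hinj U hc hv k hk
      have h5 := hx.mul ha
      rw [zero_mul] at h5
      rw [Pi.single_eq_of_ne hk]
      refine h5.congr' ?_
      filter_upwards [hu] with i hi
      rw [Pi.sub_apply, rowAction_torus, if_neg hk, hi]
      ring
  have h5 := eq_zero_of_tendsto_firstRow hφ hinj h3 h4
  simp at h5

theorem exists_tendsto_firstRow (h2 : (2 : F) ≠ 0)
    {φ : specialUpperTriangularGroup (m + 2) F →* H}
    (hφ : Continuous φ) (hinj : Function.Injective φ) (U : Ultrafilter ι)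
    {v : ι → Fin (m + 1) → F} {c : H} (hc : ∀ g, Commute c (φ g))
    (hv : Tendsto (fun i => φ (firstRow (v i))) U (𝓝 c)) :
    ∃ w, Tendsto v U (𝓝 w) := by
  have h : ∀ k, ∃ a, Tendsto (fun i => v i k) U (𝓝 a) := fun k => by
    by_cases hk : k = Fin.last m
    · exact hk ▸ exists_tendsto_last h2 hφ hinj U hc hv
    · exact exists_tendsto_of_ne_last hφ hinj U hc hv k hk
  choose w hw using h
  exact ⟨w, tendsto_pi_nhds.2 hw⟩

/-- If `φ (g i) → 1`, then `g i` becomes scalar, up to its first row. -/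
theorem tendsto_inv_mul_entry (h2 : (2 : F) ≠ 0)
    {φ : specialUpperTriangularGroup (m + 2) F →* H}
    (hφ : Continuous φ) (hinj : Function.Injective φ) (U : Ultrafilter ι)
    {g : ι → specialUpperTriangularGroup (m + 2) F}
    (hg : Tendsto (fun i => φ (g i)) U (𝓝 1)) (j k : Fin (m + 1)) :
    Tendsto (fun i => ((g i).1.1 0 0)⁻¹ * (g i).1.1 j.succ k.succ) U
      (𝓝 ((1 : Matrix (Fin (m + 1)) (Fin (m + 1)) F) j k)) := by
  have h1 : Tendsto (fun i => φ (firstRow (rowAction (g i) (Pi.single j 1) - Pi.single j 1))) U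
      (𝓝 1) := by
    have h := ((hg.inv.mul_const (φ (firstRow (Pi.single j 1)))).mul hg).mul_const
      (φ (firstRow (Pi.single j 1)))⁻¹
    rw [inv_one, one_mul, mul_one, mul_inv_cancel] at h
    refine h.congr fun i => ?_
    rw [sub_eq_add_neg, firstRow_add, firstRow_neg, ← firstRow_conj]
    simp only [map_mul, map_inv]
  obtain ⟨w, hw⟩ := exists_tendsto_firstRow h2 hφ hinj U (fun g => Commute.one_left _) h1
  rw [eq_zero_of_tendsto_firstRow hφ hinj h1 hw] at hw
  have h3 := (tendsto_pi_nhds.1 hw k).add_const ((Pi.single j 1 : Fin (m + 1) → F) k)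
  rw [Pi.zero_apply, zero_add] at h3
  have h4 : (Pi.single j 1 : Fin (m + 1) → F) k =
      (1 : Matrix (Fin (m + 1)) (Fin (m + 1)) F) j k := by
    simp [Pi.single_apply, one_apply, eq_comm]
  rw [h4] at h3
  refine h3.congr fun i => ?_
  simp [rowAction, Pi.single_apply, one_apply, eq_comm]

/-- If `φ (g i) → 1`, then the first diagonal entries of `g i` converge, to a root of unity: the
determinant shows that their powers with exponent `m + 2` tend to `1`. -/
theorem exists_tendsto_zero_zero (h2 : (2 : F) ≠ 0)
    {φ : specialUpperTriangularGroup (m + 2) F →* H}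
    (hφ : Continuous φ) (hinj : Function.Injective φ) (U : Ultrafilter ι)
    {g : ι → specialUpperTriangularGroup (m + 2) F}
    (hg : Tendsto (fun i => φ (g i)) U (𝓝 1)) :
    ∃ z : F, z ≠ 0 ∧ Tendsto (fun i => (g i).1.1 0 0) U (𝓝 z) := by
  have h1 : Tendsto (fun i => ∏ j : Fin (m + 1), ((g i).1.1 0 0)⁻¹ * (g i).1.1 j.succ j.succ) U
      (𝓝 1) := by
    have h := tendsto_finsetProd Finset.univ fun j _ => tendsto_inv_mul_entry h2 hφ hinj U hg j j
    simpa using h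
  have h3 : Tendsto (fun i => ((g i).1.1 0 0) ^ (m + 2)) U (𝓝 1) := by
    have h := h1.inv₀ one_ne_zero
    rw [inv_one] at h
    refine h.congr fun i => ?_
    have h0 := diag_ne_zero (g i) 0
    have hp := prod_diag (g i)
    rw [Fin.prod_univ_succ] at hp
    rw [Finset.prod_mul_distrib, Finset.prod_const, Finset.card_univ, Fintype.card_fin,
      eq_inv_of_mul_eq_one_right hp, inv_pow,
      mul_inv, inv_inv, inv_inv, ← pow_succ]
  rcases U.exists_tendsto_nhds_or_tendsto_inv_zero fun i => (g i).1.1 0 0 with ⟨z, hz⟩ | ⟨h, -⟩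
  · refine ⟨z, ?_, hz⟩
    rintro rfl
    have := tendsto_nhds_unique h3 (hz.pow (m + 2))
    simp at this
  · have := tendsto_nhds_unique (h3.inv₀ one_ne_zero)
      ((h.pow (m + 2)).congr fun i => inv_pow _ _)
    simp at this

/-- If `φ (g i) → 1` along an ultrafilter, then `g i → 1` entrywise. -/
theorem tendsto_one_of_tendsto_map (h2 : (2 : F) ≠ 0)
    {φ : specialUpperTriangularGroup (m + 2) F →* H}
    (hφ : Continuous φ) (hinj : Function.Injective φ) (U : Ultrafilter ι)
    {g : ι → specialUpperTriangularGroup (m + 2) F}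
    (hg : Tendsto (fun i => φ (g i)) U (𝓝 1)) : Tendsto g U (𝓝 1) := by
  obtain ⟨z, hz0, hz⟩ := exists_tendsto_zero_zero h2 hφ hinj U hg
  have hblock : ∀ j k : Fin (m + 1), Tendsto (fun i => (g i).1.1 j.succ k.succ) U
      (𝓝 (z * (1 : Matrix (Fin (m + 1)) (Fin (m + 1)) F) j k)) := fun j k =>
    (hz.mul (tendsto_inv_mul_entry h2 hφ hinj U hg j k)).congr fun i =>
      mul_inv_cancel_left₀ (diag_ne_zero (g i) 0) _
  let v : ι → Fin (m + 1) → F := fun i k => ((g i).1.1 0 0)⁻¹ * (g i).1.1 0 k.succ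
  -- Removing the first row leaves a family that converges to the scalar matrix `z`.
  have hrest : ∀ j k, Tendsto (fun i => (g i * firstRow (-v i)).1.1 j k) U
      (𝓝 (z * (1 : Matrix (Fin (m + 2)) (Fin (m + 2)) F) j k)) := by
    intro j k
    simp only [mul_entry, Fin.sum_univ_succ (n := m + 1)]
    induction j using Fin.cases with
    | zero =>
      induction k using Fin.cases with
      | zero => simpa using hz
      | succ k =>
        refine tendsto_const_nhds.congr fun i => ?_
        have := diag_ne_zero (g i) 0
        simp [v, one_apply, this, (Fin.succ_ne_zero k).symm]
    | succ j =>
      induction k using Fin.cases with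
      | zero => simp [entry_succ_zero]
      | succ k => simpa [entry_succ_zero, one_apply] using hblock j k
  obtain ⟨x, hx⟩ := exists_tendsto fun j k => ⟨_, hrest j k⟩
  have hxz : ∀ j k, x.1.1 j k = z * (1 : Matrix (Fin (m + 2)) (Fin (m + 2)) F) j k := fun j k =>
    tendsto_nhds_unique (tendsto_iff.1 hx j k) (hrest j k)
  have hcentral : ∀ y, x * y = y * x := fun y => ext_entries fun j k => by
    rw [mul_entry, mul_entry]
    simp [hxz, one_apply, mul_comm]
  have hv : Tendsto (fun i => φ (firstRow (v i))) U (𝓝 (φ x)⁻¹) := by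
    have h := (((hφ.tendsto _).comp hx).inv).mul hg
    rw [mul_one] at h
    refine h.congr fun i => ?_
    simp [firstRow_neg]
  obtain ⟨w, hw⟩ := exists_tendsto_firstRow h2 hφ hinj U (c := (φ x)⁻¹)
    (fun y => Commute.inv_left (by
      rw [Commute, SemiconjBy, ← map_mul, ← map_mul, hcentral])) hv
  obtain ⟨y, hy⟩ : ∃ y, Tendsto g U (𝓝 y) := by
    refine exists_tendsto fun j k => ?_
    induction j using Fin.cases with
    | zero =>
      induction k using Fin.cases with
      | zero => exact ⟨z, hz⟩
      | succ k =>
        exact ⟨_, (hz.mul (tendsto_pi_nhds.1 hw k)).congr fun i =>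
          mul_inv_cancel_left₀ (diag_ne_zero (g i) 0) _⟩
    | succ j =>
      induction k using Fin.cases with
      | zero => exact ⟨0, tendsto_const_nhds.congr fun i => (entry_succ_zero (g i) j).symm⟩
      | succ k => exact ⟨_, hblock j k⟩
  have hy1 : φ y = φ 1 := by
    rw [map_one]
    exact tendsto_nhds_unique ((hφ.tendsto _).comp hy) hg
  exact hinj hy1 ▸ hy

end Coarser

theorem isTopologicalGroup (n : ℕ) (F : Type*) [Field F] [TopologicalSpace F]
    [IsTopologicalRing F] : IsTopologicalGroup (specialUpperTriangularGroup n F) :=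
  inferInstance

theorem t2Space (n : ℕ) (F : Type*) [Field F] [TopologicalSpace F] [T2Space F] :
    T2Space (specialUpperTriangularGroup n F) := by
  have : T2Space (Matrix.SpecialLinearGroup (Fin n) F) :=
    inferInstanceAs (T2Space {A : Matrix (Fin n) (Fin n) F // A.det = 1})
  infer_instance

theorem subsingleton_of_le_one {n : ℕ} (hn : n ≤ 1) (F : Type*) [Field F] :
    Subsingleton (specialUpperTriangularGroup n F) := by
  have : Subsingleton (Fin n) := Fin.subsingleton_iff_le_one.2 hn
  refine ⟨fun g h => ext_entries fun i j => ?_⟩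
  obtain rfl := Subsingleton.elim i j
  have key : ∀ g : specialUpperTriangularGroup n F, g.1.1 i i = 1 := fun g => by
    have := prod_diag g
    rwa [Fintype.prod_subsingleton _ i] at this
  rw [key g, key h]

end specialUpperTriangularGroup

theorem theorem4p9 (F : Type*) [Field F] [TopologicalSpace F] [IsTopologicalLocalField F]
    (hF : ringChar F ≠ 2) (n : ℕ) :
    IsMinimalTopologicalGroup (specialUpperTriangularGroup n F) := by
  refine ⟨specialUpperTriangularGroup.isTopologicalGroup n F,
    specialUpperTriangularGroup.t2Space n F, fun s hs hs2 hle => ?_⟩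
  obtain hn | ⟨m, rfl⟩ : n ≤ 1 ∨ ∃ m, n = m + 2 := by
    rcases Nat.lt_or_ge 1 n with h | h
    · exact Or.inr ⟨n - 2, by omega⟩
    · exact Or.inl h
  · have := specialUpperTriangularGroup.subsingleton_of_le_one hn F
    exact Subsingleton.elim _ _
  refine hs.ext (specialUpperTriangularGroup.isTopologicalGroup _ F)
    (le_antisymm ?_ (nhds_mono hle))
  refine le_iff_ultrafilter.2 fun U hU => ?_
  exact @specialUpperTriangularGroup.tendsto_one_of_tendsto_map F _ _ m
    (specialUpperTriangularGroup (m + 2) F) _ s _ _ hs hs2 (Ring.two_ne_zero hF)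
    (MonoidHom.id _) (continuous_id_iff_le.2 hle) Function.injective_id U id hU
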